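/- **Proposition 4.1 (Master J-fraction for permutations, $\lambda=-1$).** For $\sigma\in\mathfrak S_n$ let $\mathrm{cyc}(\sigma)$ be its number of cycles (fixed points included), and let $\mathrm{Cval}(\sigma)=\{i:\sigma^{-1}(i)>i<\sigma(i)\}$, $\mathrm{Cpeak}(\sigma)=\{i:\sigma^{-1}(i)<i>\sigma(i)\}$, $\mathrm{Cdfall}(\sigma)=\{i:\sigma^{-1}(i)>i>\sigma(i)\}$, $\mathrm{Cdrise}(\sigma)=\{i:\sigma^{-1}(i)<i<\sigma(i)\}$, $\mathrm{Fix}(\sigma)=\{i:\sigma(i)=i\}$. Define $$\begin{aligned} \mathrm{ucross}(j,\sigma)&=\#\{i<j<k<l:\ k=\sigma(i),\ l=\sigma(j)\}\quad\text{($j$ fixed)},\\ \mathrm{unest}(j,\sigma)&=\#\{i<j<k<l:\ k=\sigma(j),\ l=\sigma(i)\}\quad\text{($j$ fixed)},\\ \mathrm{lcross}(k,\sigma)&=\#\{i<j<k<l:\ i=\sigma(k),\ j=\sigma(l)\}\quad\text{($k$ fixed)},\\ \mathrm{lnest}(k,\sigma)&=\#\{i<j<k<l:\ i=\sigma(l),\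 j=\sigma(k)\}\quad\text{($k$ fixed)}, \end{aligned}$$ and, for a fixed point $j$ of $\sigma$, $\mathrm{psnest}(j,\sigma)=\#\{i<j:\ \sigma(i)>j\}$. Let $\mathsf a=(\mathsf a_{\ell,\ell'})$, $\mathsf b=(\mathsf b_{\ell,\ell'})$, $\mathsf c=(\mathsf c_{\ell,\ell'})$, $\mathsf d=(\mathsf d_{\ell,\ell'})$, $\mathsf e=(\mathsf e_\ell)$ ($\ell,\ell'\ge 0$) be families of elements of a commutative ring $R$ (for instance, indeterminates in a polynomial ring over $\mathbb Z$), and for $\lambda\in R$ put $$P_n(\mathsf a,\mathsf b,\mathsf c,\mathsf d,\mathsf e,\lambda)=\sum_{\sigma\in\mathfrak S_n}\lambda^{\mathrm{cyc}(\sigma)} \prod_{i\in\mathrm{Cval}(\sigma)}\mathsf a_{\mathrm{ucross}(i,\sigma),\mathrm{unest}(i,\sigma)} \prod_{i\in\mathrm{Cpeak}(\sigma)}\mathsf b_{\mathrm{lcross}(i,\sigma),\mathrm{lnest}(i,\sigma)} \prod_{i\in\mathrm{Cdfall}(\sigma)}\mathsf c_{\mathrm{lcross}(i,\sigma),\mathrm{lnest}(i,\sigma)}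 \prod_{i\in\mathrm{Cdrise}(\sigma)}\mathsf d_{\mathrm{ucross}(i,\sigma),\mathrm{unest}(i,\sigma)} \prod_{i\in\mathrm{Fix}(\sigma)}\mathsf e_{\mathrm{psnest}(i,\sigma)} .$$ Then, as formal power series in $t$ over $R$, $$\sum_{n=0}^\infty P_n(\mathsf a,\mathsf b,\mathsf c,\mathsf d,\mathsf e,-1)\,t^n=\cfrac{1}{1-\gamma_0t-\cfrac{\beta_1t^2}{1-\gamma_1t-\cfrac{\beta_2t^2}{1-\cdots}}}$$ (the right-hand side being the coefficientwise limit of its finite truncations), where $$\gamma_n=\sum_{\ell=0}^{n-1}(-1)^\ell\,\mathsf c_{\ell,n-1-\ell}+\sum_{\ell=0}^{n-1}(-1)^\ell\,\mathsf d_{\ell,n-1-\ell}-\mathsf e_n\quad(n\ge 0),$$ $$\beta_n=-\Bigl(\sum_{\ell=0}^{n-1}(-1)^\ell\,\mathsf a_{\ell,n-1-\ell}\Bigr)\Bigl(\sum_{\ell=0}^{n-1}(-1)^\ell\,\mathsf b_{\ell,n-1-\ell}\Bigr)\quad(n\ge 1).$$ -/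

import Mathlib

open Filter
open scoped PowerSeries

namespace MasterJ

section PermutationStatistics

variable {n : ℕ}

/-- Cycle peaks of a permutation. -/
def Cpeak (σ : Equiv.Perm (Fin n)) : Finset (Fin n) :=
  Finset.univ.filter fun i => σ⁻¹ i < i ∧ i > σ i

/-- Cycle valleys of a permutation. -/
def Cval (σ : Equiv.Perm (Fin n)) : Finset (Fin n) :=
  Finset.univ.filter fun i => σ⁻¹ i > i ∧ i < σ i

/-- Cycle double rises of a permutation. -/
def Cdrise (σ : Equiv.Perm (Fin n)) : Finset (Fin n) :=
  Finset.univ.filter fun i => σ⁻¹ i < i ∧ i < σ i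

/-- Cycle double falls of a permutation. -/
def Cdfall (σ : Equiv.Perm (Fin n)) : Finset (Fin n) :=
  Finset.univ.filter fun i => σ⁻¹ i > i ∧ i > σ i

/-- Fixed points of a permutation. -/
def Fix (σ : Equiv.Perm (Fin n)) : Finset (Fin n) :=
  Finset.univ.filter fun i => σ i = i

/-- `ucross(j, σ) = #{i < j < k < l : k = σ(i), l = σ(j)}`; the triples below are `(i, k, l)`. -/
def ucross (j : Fin n) (σ : Equiv.Perm (Fin n)) : ℕ :=
  (Finset.univ.filter fun q : Fin n × Fin n × Fin n =>
    q.1 < j ∧ j < q.2.1 ∧ q.2.1 < q.2.2 ∧ q.2.1 = σ q.1 ∧ q.2.2 = σ j).card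

/-- `unest(j, σ) = #{i < j < k < l : k = σ(j), l = σ(i)}`; the triples below are `(i, k, l)`. -/
def unest (j : Fin n) (σ : Equiv.Perm (Fin n)) : ℕ :=
  (Finset.univ.filter fun q : Fin n × Fin n × Fin n =>
    q.1 < j ∧ j < q.2.1 ∧ q.2.1 < q.2.2 ∧ q.2.1 = σ j ∧ q.2.2 = σ q.1).card

/-- `lcross(k, σ) = #{i < j < k < l : i = σ(k), j = σ(l)}`; the triples below are `(i, j, l)`. -/
def lcross (k : Fin n) (σ : Equiv.Perm (Fin n)) : ℕ :=
  (Finset.univ.filter fun q : Fin n × Fin n × Fin n =>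
    q.1 < q.2.1 ∧ q.2.1 < k ∧ k < q.2.2 ∧ q.1 = σ k ∧ q.2.1 = σ q.2.2).card

/-- `lnest(k, σ) = #{i < j < k < l : i = σ(l), j = σ(k)}`; the triples below are `(i, j, l)`. -/
def lnest (k : Fin n) (σ : Equiv.Perm (Fin n)) : ℕ :=
  (Finset.univ.filter fun q : Fin n × Fin n × Fin n =>
    q.1 < q.2.1 ∧ q.2.1 < k ∧ k < q.2.2 ∧ q.1 = σ q.2.2 ∧ q.2.1 = σ k).card

/-- `psnest(j, σ) = #{i < j : σ(i) > j}` (used when `j` is a fixed point). -/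
def psnest (j : Fin n) (σ : Equiv.Perm (Fin n)) : ℕ :=
  (Finset.univ.filter fun i : Fin n => i < j ∧ σ i > j).card

/-- The number of cycles of a permutation, every fixed point counting as a cycle. -/
def cyc (σ : Equiv.Perm (Fin n)) : ℕ :=
  Multiset.card σ.partition.parts

end PermutationStatistics

/-- The master polynomial `P_n(a, b, c, d, e, lam)`, the families `a, b, c, d, e` and `lam` taking
values in a commutative ring (for instance, being indeterminates of a polynomial ring). -/
def masterP {R : Type*} [CommRing R] (a b c d : ℕ → ℕ → R) (e : ℕ → R) (lam : R) (n : ℕ) : R :=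
  ∑ σ : Equiv.Perm (Fin n),
    lam ^ cyc σ
      * (∏ i ∈ Cval σ, a (ucross i σ) (unest i σ))
      * (∏ i ∈ Cpeak σ, b (lcross i σ) (lnest i σ))
      * (∏ i ∈ Cdfall σ, c (lcross i σ) (lnest i σ))
      * (∏ i ∈ Cdrise σ, d (ucross i σ) (unest i σ))
      * (∏ i ∈ Fix σ, e (psnest i σ))

/-- `jConv γ β m k` is the finite continued fraction
`1/(1 - γ_k t - β_{k+1} t²/(1 - γ_{k+1} t - β_{k+2} t²/(⋯ /(1 - γ_{k+m} t))))`,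
as a formal power series in `t`. -/
noncomputable def jConv {R : Type*} [CommRing R] (γ β : ℕ → R) : ℕ → ℕ → R⟦X⟧
  | 0, k => PowerSeries.invOfUnit (1 - PowerSeries.C (γ k) * PowerSeries.X) 1
  | m + 1, k =>
      PowerSeries.invOfUnit
        (1 - PowerSeries.C (γ k) * PowerSeries.X
          - PowerSeries.C (β (k + 1)) * PowerSeries.X ^ 2 * jConv γ β m (k + 1)) 1

/-- The denominators in `jConv` have constant term `1`, so `jConv` really is their inverse. -/
theorem jConv_zero_mul {R : Type*} [CommRing R] (γ β : ℕ → R) (k : ℕ) :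
    (1 - PowerSeries.C (γ k) * PowerSeries.X) * jConv γ β 0 k = 1 := by
  rw [jConv]
  exact PowerSeries.mul_invOfUnit _ _ (by simp)

theorem jConv_succ_mul {R : Type*} [CommRing R] (γ β : ℕ → R) (m k : ℕ) :
    (1 - PowerSeries.C (γ k) * PowerSeries.X
      - PowerSeries.C (β (k + 1)) * PowerSeries.X ^ 2 * jConv γ β m (k + 1))
        * jConv γ β (m + 1) k = 1 := by
  rw [jConv]
  exact PowerSeries.mul_invOfUnit _ _ (by simp)

/-- `f = 1/(1 - γ_0 t - β_1 t²/(1 - γ_1 t - β_2 t²/(1 - ⋯)))` as formal power series: `f` is the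
limit of the finite continued fractions, in the sense that each coefficient is eventually constant
with value the coefficient of `f`. -/
def HasJFraction {R : Type*} [CommRing R] (f : R⟦X⟧) (γ β : ℕ → R) : Prop :=
  ∀ N : ℕ, ∀ᶠ m in atTop, PowerSeries.coeff N (jConv γ β m 0) = PowerSeries.coeff N f

end MasterJ

/-! The factor `(-1) ^ cyc σ` is local: up to `(-1) ^ n` it is the sign of `σ`, and a parity count
of arcs writes it as a product over `i` of signs depending only on the type of `i` and its crossing
number (`neg_one_pow_cyc_eq`). The signs are absorbed into the weights: `a`, `c`, `d` acquire `(-1)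
^ l`, `b` acquires `-(-1) ^ l`, and `e` acquires `-1`. No cycle count remains.

A permutation is a word of types together with two independent bijections, one carrying the upper
arcs and one the lower arcs (`sum_permType`). Assign the images of the upper sources from the
largest source down. The targets available to a source number as many as a height fixed by the type
word, and the rank of the chosen target gives the crossings (targets below it) and the nestings
(targets above it). Each choice therefore sums to an antidiagonal sum `diagSum`, independently of
the others (`sum_partialBij`); reversing the order handles lower arcs.

What is left is a weighted count of coloured Motzkin paths (`sum_permWeight`), whose first-step
recurrence in the starting height yields the continued fraction (`hasJFraction_of_recurrence`). -/

namespace MasterJ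

/-! ### Continued fractions from tridiagonal recurrences -/

/-- The solution of the tridiagonal system truncated at height `m`, in terms of the convergents. -/
noncomputable def truncatedSolution {R : Type*} [CommRing R] (γ β B : ℕ → R) (m : ℕ) : ℕ → R⟦X⟧
  | 0 => jConv γ β m 0
  | h + 1 => PowerSeries.C (B (h + 1)) * PowerSeries.X * jConv γ β (m - (h + 1)) (h + 1)
      * truncatedSolution γ β B m h

theorem truncatedSolution_zero {R : Type*} [CommRing R] {γ β A B : ℕ → R}
    (hβ : ∀ h, β (h + 1) = A h * B (h + 1)) {m : ℕ} (hm : 0 < m) :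
    truncatedSolution γ β B m 0 = 1 + PowerSeries.X *
      (PowerSeries.C (A 0) * truncatedSolution γ β B m 1
        + PowerSeries.C (γ 0) * truncatedSolution γ β B m 0) := by
  obtain ⟨k, rfl⟩ : ∃ k, m = k + 1 := ⟨m - 1, by omega⟩
  have h := jConv_succ_mul γ β k 0
  rw [hβ, map_mul] at h
  simp only [truncatedSolution, zero_add, Nat.add_sub_cancel] at h ⊢
  linear_combination h

/-- The definition is a first-passage decomposition: stay at height at least `h + 1`, step down
once, continue from `h`. Clearing the denominator of one convergent turns it into the first-step
recurrence. The bound on `h` excludes the top height `m`, where no step up exists. -/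
theorem truncatedSolution_succ {R : Type*} [CommRing R] {γ β A B : ℕ → R}
    (hβ : ∀ h, β (h + 1) = A h * B (h + 1)) {m h : ℕ} (hm : h + 1 < m) :
    truncatedSolution γ β B m (h + 1) = PowerSeries.X *
      (PowerSeries.C (A (h + 1)) * truncatedSolution γ β B m (h + 2)
        + PowerSeries.C (γ (h + 1)) * truncatedSolution γ β B m (h + 1)
        + PowerSeries.C (B (h + 1)) * truncatedSolution γ β B m h) := by
  obtain ⟨k, rfl⟩ : ∃ k, m = k + (h + 2) := ⟨m - (h + 2), by omega⟩
  have e1 : k + (h + 2) - (h + 1) = k + 1 := by omega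
  have e2 : k + (h + 2) - (h + 1 + 1) = k := by omega
  have H := jConv_succ_mul γ β k (h + 1)
  rw [hβ, map_mul] at H
  simp only [truncatedSolution, e1, e2] at H ⊢
  linear_combination (PowerSeries.C (B (h + 1)) * PowerSeries.X
    * truncatedSolution γ β B (k + (h + 2)) h) * H

theorem constantCoeff_jConv {R : Type*} [CommRing R] (γ β : ℕ → R) (m k : ℕ) :
    PowerSeries.constantCoeff (jConv γ β m k) = 1 := by
  cases m with
  | zero => simpa using congrArg PowerSeries.constantCoeff (jConv_zero_mul γ β k)
  | succ m => simpa using congrArg PowerSeries.constantCoeff (jConv_succ_mul γ β m k)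

/-- Flajolet's theorem, in the form of a tridiagonal recurrence. -/
theorem hasJFraction_of_recurrence {R : Type*} [CommRing R] {γ β A B : ℕ → R} {Q : ℕ → ℕ → R}
    (hβ : ∀ h, β (h + 1) = A h * B (h + 1))
    (Q_zero : Q 0 0 = 1) (Q_succ : ∀ h, Q (h + 1) 0 = 0)
    (rec_zero : ∀ n, Q 0 (n + 1) = A 0 * Q 1 n + γ 0 * Q 0 n)
    (rec_succ : ∀ h n, Q (h + 1) (n + 1)
      = A (h + 1) * Q (h + 2) n + γ (h + 1) * Q (h + 1) n + B (h + 1) * Q h n) :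
    HasJFraction (PowerSeries.mk (Q 0)) γ β := by
  intro N
  filter_upwards [eventually_ge_atTop N] with m hm
  -- Each application of the recurrence raises the height by at most one, so with `h + N ≤ m` the
  -- truncation at `m` is never felt.
  have key : ∀ N h, h + N ≤ m →
      PowerSeries.coeff N (truncatedSolution γ β B m h) = Q h N := by
    intro N
    induction N with
    | zero =>
      rintro (_ | h) _
      · simp [truncatedSolution, constantCoeff_jConv, Q_zero]
      · simp [truncatedSolution, Q_succ]
    | succ N ih =>
      rintro (_ | h) hN
      · rw [truncatedSolution_zero hβ (by omega), map_add, PowerSeries.coeff_succ_X_mul, map_add,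
          PowerSeries.coeff_C_mul, PowerSeries.coeff_C_mul, ih _ (by omega), ih _ (by omega),
          rec_zero, PowerSeries.coeff_one]
        simp
      · rw [truncatedSolution_succ hβ (by omega), PowerSeries.coeff_succ_X_mul, map_add, map_add,
          PowerSeries.coeff_C_mul, PowerSeries.coeff_C_mul, PowerSeries.coeff_C_mul,
          ih _ (by omega), ih _ (by omega), ih _ (by omega), rec_succ]
  have := key N 0 (by omega)
  rw [PowerSeries.coeff_mk]
  exact this

/-! ### Coloured Motzkin paths -/

/-- The five possible steps of the coloured Motzkin path of a permutation. -/
inductive Step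
  | val
  | peak
  | dfall
  | drise
  | fixed
  deriving DecidableEq

instance : Fintype Step where
  elems := {.val, .peak, .dfall, .drise, .fixed}
  complete := by rintro ⟨⟩ <;> decide

theorem Step.sum_univ {R : Type*} [CommRing R] (f : Step → R) :
    ∑ s, f s = f .val + f .peak + f .dfall + f .drise + f .fixed := by
  have h : (Finset.univ : Finset Step) = {.val, .peak, .dfall, .drise, .fixed} := rfl
  rw [h]
  repeat rw [Finset.sum_insert (by decide)]
  rw [Finset.sum_singleton]
  ring

theorem sum_step_paths_succ {R : Type*} [CommRing R] {n : ℕ} (f : (Fin (n + 1) → Step) → R) :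
    ∑ τ, f τ = ∑ s, ∑ τ : Fin n → Step, f (Fin.cons s τ) := by
  rw [← (Fin.consEquiv fun _ : Fin (n + 1) => Step).sum_comp, Fintype.sum_prod_type]
  rfl

/-- The total weight of a step that starts at height `x - y`. -/
def stepWeight {R : Type*} (va vb vc vd ve : ℕ → R) (x y : ℕ) : Step → R
  | .val => va (x + 1 - y)
  | .peak => vb (x - y)
  | .dfall => vc (x - y)
  | .drise => vd (x - y)
  | .fixed => ve (x - y)

/-- Generating polynomial of coloured Motzkin paths of length `n` from height `h` to height `0`. -/
def pathSum {R : Type*} [CommRing R] (va vb vc vd ve : ℕ → R) (h n : ℕ) : R :=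
  ∑ τ : Fin n → Step,
    if h + (Finset.univ.filter fun i => τ i = .val).card
        = (Finset.univ.filter fun i => τ i = .peak).card then
      ∏ i, stepWeight va vb vc vd ve
        (h + (Finset.univ.filter fun j => j < i ∧ τ j = .val).card)
        (Finset.univ.filter fun j => j < i ∧ τ j = .peak).card (τ i)
    else 0

theorem card_filter_cons {n : ℕ} (s t : Step) (τ : Fin n → Step) :
    (Finset.univ.filter fun i => (Fin.cons s τ : Fin (n + 1) → Step) i = t).card
      = (if s = t then 1 else 0) + (Finset.univ.filter fun i => τ i = t).card := by
  rw [Finset.card_filter, Finset.card_filter, Fin.sum_univ_succ]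
  simp

theorem card_filter_lt_cons {n : ℕ} (s t : Step) (τ : Fin n → Step) (i : Fin n) :
    (Finset.univ.filter fun j =>
        j < i.succ ∧ (Fin.cons s τ : Fin (n + 1) → Step) j = t).card
      = (if s = t then 1 else 0) + (Finset.univ.filter fun j => j < i ∧ τ j = t).card := by
  rw [Finset.card_filter, Finset.card_filter, Fin.sum_univ_succ]
  simp

/-- Removing the first step shifts the starting height. A word that would descend below `0` must
take a peak step at height `0`, so `hvb` kills it; this also makes the truncated `h - 1` harmless.
-/
theorem pathSum_succ {R : Type*} [CommRing R] {va vb vc vd ve : ℕ → R} (hvb : vb 0 = 0) (h n : ℕ) :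
    pathSum va vb vc vd ve h (n + 1)
      = va (h + 1) * pathSum va vb vc vd ve (h + 1) n
        + (vc h + vd h + ve h) * pathSum va vb vc vd ve h n
        + vb h * pathSum va vb vc vd ve (h - 1) n := by
  unfold pathSum
  rw [sum_step_paths_succ, Step.sum_univ]
  simp only [Fin.prod_univ_succ, card_filter_cons,
    card_filter_lt_cons, Fin.cons_zero, Fin.cons_succ, Fin.not_lt_zero, false_and,
    Finset.filter_false, Finset.card_empty]
  simp only [reduceCtorEq, if_true, if_false, zero_add, add_zero, Nat.sub_zero, stepWeight,
    ← add_assoc]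
  simp only [← mul_ite_zero, ← Finset.mul_sum]
  rcases h with _ | h
  · simp only [hvb]; ring
  · have e : ∀ x y : ℕ, h + 1 + x - (1 + y) = h + x - y := by intros; omega
    have e1 : ∀ x y : ℕ, h + 1 + x + 1 - (1 + y) = h + x + 1 - y := by intros; omega
    have e' : ∀ x y : ℕ, (h + 1 + x = 1 + y) = (h + x = y) := by intros; simp; omega
    simp only [e, e1, e', Nat.add_sub_cancel]
    ring

theorem hasJFraction_pathSum {R : Type*} [CommRing R] {va vb vc vd ve : ℕ → R} (hvb : vb 0 = 0) :
    HasJFraction (PowerSeries.mk (pathSum va vb vc vd ve 0)) (fun n => vc n + vd n + ve n)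
      (fun n => va n * vb n) := by
  refine hasJFraction_of_recurrence (A := fun h => va (h + 1)) (B := vb) (fun _ => rfl) ?_ ?_ ?_ ?_
  · simp [pathSum]
  · simp [pathSum]
  · intro n
    rw [pathSum_succ hvb, hvb]
    ring
  · intro h n
    rw [pathSum_succ hvb, Nat.add_sub_cancel]

end MasterJ

/-! ### Bijections between sources and targets of arcs -/

namespace MasterJ

/-- The sum of a family over the antidiagonal of index `k - 1`. -/
def diagSum {R : Type*} [CommRing R] (a : ℕ → ℕ → R) (k : ℕ) : R :=
  ∑ l ∈ Finset.range k, a l (k - 1 - l)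

section PartialBijections

variable {α : Type*} [LinearOrder α] [Fintype α]

open Classical in
/-- The self-maps that restrict to a bijection from `F` to `G` and fix everything outside `F`. -/
noncomputable def partialBij (F G : Finset α) : Finset (α → α) :=
  Finset.univ.filter fun φ => Set.BijOn φ F G ∧ ∀ x ∉ F, φ x = x

theorem mem_partialBij {F G : Finset α} {φ : α → α} :
    φ ∈ partialBij F G ↔ Set.BijOn φ F G ∧ ∀ x ∉ F, φ x = x := by
  simp [partialBij]

theorem card_eq_of_mem_partialBij {F G : Finset α} {φ : α → α} (h : φ ∈ partialBij F G) :
    F.card = G.card := by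
  have := (mem_partialBij.1 h).1
  exact Finset.card_bij (fun x _ => φ x) (fun x hx => this.mapsTo hx)
    (fun x hx y hy e => this.injOn hx hy e) (fun y hy => by
      obtain ⟨x, hx, e⟩ := this.surjOn hy
      exact ⟨x, hx, e⟩)

theorem update_mem_partialBij_erase {F G : Finset α} {m : α} (hm : m ∉ F) {φ : α → α}
    (h : φ ∈ partialBij (insert m F) G) :
    Function.update φ m m ∈ partialBij F (G.erase (φ m)) := by
  obtain ⟨hb, hid⟩ := mem_partialBij.1 h
  have hne : ∀ x ∈ F, x ≠ m := fun x hx e => hm (e ▸ hx)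
  refine mem_partialBij.2 ⟨⟨?_, ?_, ?_⟩, ?_⟩
  · intro x hx
    have hx' : x ∈ F := hx
    simp only [Function.update_of_ne (hne x hx'), Finset.coe_erase]
    exact ⟨hb.mapsTo (by simp [hx']), fun e => hne x hx'
      (hb.injOn (by simp [hx']) (by simp) e)⟩
  · intro x hx y hy e
    have hx' : x ∈ F := hx
    have hy' : y ∈ F := hy
    rw [Function.update_of_ne (hne x hx'), Function.update_of_ne (hne y hy')] at e
    exact hb.injOn (by simp [hx']) (by simp [hy']) e
  · intro y hy
    have hy' : y ≠ φ m ∧ y ∈ G := by simpa [and_comm] using hy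
    obtain ⟨x, hx, rfl⟩ := hb.surjOn hy'.2
    have hxm : x ≠ m := fun e => hy'.1 (e ▸ rfl)
    refine ⟨x, ?_, Function.update_of_ne hxm _ _⟩
    have : x = m ∨ x ∈ F := by simpa using hx
    exact this.resolve_left hxm
  · intro x hx
    by_cases e : x = m
    · subst e; simp
    · rw [Function.update_of_ne e]
      exact hid x (by simp [e, hx])

theorem update_mem_partialBij_insert {F G : Finset α} {m g : α} (hm : m ∉ F) (hg : g ∈ G)
    {φ : α → α} (h : φ ∈ partialBij F (G.erase g)) :
    Function.update φ m g ∈ partialBij (insert m F) G := by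
  obtain ⟨hb, hid⟩ := mem_partialBij.1 h
  have hne : ∀ x ∈ F, x ≠ m := fun x hx e => hm (e ▸ hx)
  have hmaps : ∀ x ∈ F, φ x ≠ g ∧ φ x ∈ G := fun x hx => by
    simpa [and_comm] using hb.mapsTo (Finset.mem_coe.2 hx)
  refine mem_partialBij.2 ⟨⟨?_, ?_, ?_⟩, ?_⟩
  · intro x hx
    rcases (by simpa using hx : x = m ∨ x ∈ F) with rfl | hx'
    · simpa using hg
    · rw [Function.update_of_ne (hne x hx')]
      exact (hmaps x hx').2
  · intro x hx y hy e
    rcases (by simpa using hx : x = m ∨ x ∈ F) with rfl | hx' <;>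
    rcases (by simpa using hy : y = _ ∨ y ∈ F) with rfl | hy'
    · rfl
    · rw [Function.update_self, Function.update_of_ne (hne y hy')] at e
      exact absurd e.symm (hmaps y hy').1
    · rw [Function.update_self, Function.update_of_ne (hne x hx')] at e
      exact absurd e (hmaps x hx').1
    · rw [Function.update_of_ne (hne x hx'), Function.update_of_ne (hne y hy')] at e
      exact hb.injOn hx' hy' e
  · intro y hy
    by_cases e : y = g
    · exact ⟨m, by simp, by simp [e]⟩
    · obtain ⟨x, hx, rfl⟩ := hb.surjOn (show y ∈ ((G.erase g : Finset α) : Set α) by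
        simpa [e] using hy)
      exact ⟨x, by simp [Finset.mem_coe.1 hx], Function.update_of_ne (hne x hx) _ _⟩
  · intro x hx
    have hx' : x ≠ m ∧ x ∉ F := by simpa using hx
    rw [Function.update_of_ne hx'.1]
    exact hid x hx'.2

/-- Choose the image of `m` first. Resetting the value at `m` to `m` respects the convention of
being the identity off `F`, which makes the correspondence invertible. -/
theorem sum_partialBij_insert {R : Type*} [CommRing R] {F G : Finset α} {m : α} (hm : m ∉ F)
    (f : (α → α) → R) :
    ∑ φ ∈ partialBij (insert m F) G, f φ
      = ∑ g ∈ G, ∑ φ ∈ partialBij F (G.erase g), f (Function.update φ m g) := by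
  rw [Finset.sum_sigma']
  refine Finset.sum_bij' (fun φ _ => ⟨φ m, Function.update φ m m⟩)
    (fun p _ => Function.update p.2 m p.1) ?_ ?_ ?_ ?_ ?_
  · intro φ hφ
    refine Finset.mem_sigma.2 ⟨?_, update_mem_partialBij_erase hm hφ⟩
    exact (mem_partialBij.1 hφ).1.mapsTo (by simp)
  · rintro ⟨g, φ⟩ hp
    obtain ⟨hg, hφ⟩ := Finset.mem_sigma.1 hp
    exact update_mem_partialBij_insert hm hg hφ
  · intro φ _
    simp
  · rintro ⟨g, φ⟩ hp
    obtain ⟨hg, hφ⟩ := Finset.mem_sigma.1 hp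
    have : φ m = m := (mem_partialBij.1 hφ).2 m hm
    simp only [Function.update_self, Function.update_idem, Sigma.mk.injEq, heq_eq_eq, true_and]
    rw [Function.update_eq_self_iff, this]
  · intro φ _
    simp

/-- The number of arcs of `φ` that start before `i`, pass over it and cross the arc of `i`. -/
def crossing (φ : α → α) (i : α) : ℕ :=
  (Finset.univ.filter fun j => j < i ∧ i < φ j ∧ φ j < φ i).card

/-- The number of arcs of `φ` that nest the upper arc starting at `i`. -/
def nesting (φ : α → α) (i : α) : ℕ :=
  (Finset.univ.filter fun j => j < i ∧ φ i < φ j).card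

theorem sum_rank {β R : Type*} [LinearOrder β] [CommRing R] (S : Finset β) (f : ℕ → R) :
    ∑ g ∈ S, f (S.filter (· < g)).card = ∑ l ∈ Finset.range S.card, f l := by
  induction S using Finset.induction_on_max with
  | empty => simp
  | insert m S hm ih =>
    have hmS : m ∉ S := fun h => lt_irrefl _ (hm m h)
    rw [Finset.sum_insert hmS, Finset.card_insert_of_notMem hmS, Finset.sum_range_succ, ← ih,
      add_comm]
    congr 1
    · refine Finset.sum_congr rfl fun g hg => ?_
      rw [Finset.filter_insert, if_neg (hm g hg).not_gt]
    · rw [Finset.filter_insert, if_neg (lt_irrefl _), Finset.filter_true_of_mem hm]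

/-- An element with `l` elements of `S` below it has `S.card - 1 - l` above it, and every rank
occurs once. -/
theorem sum_rank_pair {β R : Type*} [LinearOrder β] [CommRing R] (S : Finset β) (f : ℕ → ℕ → R) :
    ∑ g ∈ S, f (S.filter (· < g)).card (S.filter (g < ·)).card = diagSum f S.card := by
  rw [diagSum, ← sum_rank S fun l => f l (S.card - 1 - l)]
  refine Finset.sum_congr rfl fun g hg => ?_
  congr 1
  have h : S = S.filter (· < g) ∪ insert g (S.filter (g < ·)) := by
    ext x
    simp only [Finset.mem_union, Finset.mem_filter, Finset.mem_insert]
    constructor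
    · intro hx
      rcases lt_trichotomy x g with h | h | h <;> simp [h, hx]
    · rintro (h | rfl | h)
      exacts [h.1, hg, h.1]
  have hc := congrArg Finset.card h
  rw [Finset.card_union_of_disjoint, Finset.card_insert_of_notMem (by simp)] at hc
  · omega
  · rw [Finset.disjoint_left]
    intro x hx hx'
    simp only [Finset.mem_filter, Finset.mem_insert] at hx hx'
    rcases hx' with rfl | h'
    · exact lt_irrefl _ hx.2
    · exact lt_asymm hx.2 h'.2

/-- Only the values at `i` and at points below `i` enter, so redirecting a later source changes
nothing. -/
theorem crossing_update_of_lt {φ : α → α} {m g i : α} (h : i < m) :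
    crossing (Function.update φ m g) i = crossing φ i := by
  unfold crossing
  congr 1
  refine Finset.filter_congr fun j _ => and_congr_right fun hj => ?_
  rw [Function.update_of_ne h.ne, Function.update_of_ne (hj.trans h).ne]

theorem nesting_update_of_lt {φ : α → α} {m g i : α} (h : i < m) :
    nesting (Function.update φ m g) i = nesting φ i := by
  unfold nesting
  congr 1
  refine Finset.filter_congr fun j _ => and_congr_right fun hj => ?_
  rw [Function.update_of_ne h.ne, Function.update_of_ne (hj.trans h).ne]

/-- Counting the arcs over `m` by their end points. -/
theorem card_filter_image_partialBij {F G : Finset α} {m : α} (hm : ∀ x ∈ F, x < m) {φ : α → α}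
    (h : φ ∈ partialBij F G) (p : α → Prop) [DecidablePred p] (hp : ∀ x, p x → m < x) :
    (Finset.univ.filter fun j => j < m ∧ p (φ j)).card = (G.filter p).card := by
  obtain ⟨hb, hid⟩ := mem_partialBij.1 h
  have hF : ∀ j, j < m → p (φ j) → j ∈ F := by
    intro j hj hpj
    by_contra hn
    rw [hid j hn] at hpj
    exact lt_asymm hj (hp _ hpj)
  refine Finset.card_bij (fun j _ => φ j) ?_ ?_ ?_
  · intro j hj
    simp only [Finset.mem_filter, Finset.mem_univ, true_and] at hj
    exact Finset.mem_filter.2 ⟨hb.mapsTo (hF j hj.1 hj.2), hj.2⟩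
  · intro j hj k hk e
    simp only [Finset.mem_filter, Finset.mem_univ, true_and] at hj hk
    exact hb.injOn (hF j hj.1 hj.2) (hF k hk.1 hk.2) e
  · intro y hy
    rw [Finset.mem_filter] at hy
    obtain ⟨x, hx, rfl⟩ := hb.surjOn hy.1
    exact ⟨x, by simp [hm x hx, hy.2], rfl⟩

/-- Since `m` is beyond all other sources, every target except `g` ends an arc starting before `m`;
the crossings are then the rank of `g` among targets beyond `m`. -/
theorem crossing_update_self {F G : Finset α} {m g : α} (hm : ∀ x ∈ F, x < m) {φ : α → α}
    (h : φ ∈ partialBij F (G.erase g)) :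
    crossing (Function.update φ m g) m = ((G.filter (m < ·)).filter (· < g)).card := by
  have := card_filter_image_partialBij hm h (fun x => m < x ∧ x < g) (fun x hx => hx.1)
  rw [Finset.filter_filter]
  have e : (G.erase g).filter (fun x => m < x ∧ x < g) = G.filter (fun x => m < x ∧ x < g) := by
    ext x
    simp only [Finset.mem_filter, Finset.mem_erase]
    exact ⟨fun hx => ⟨hx.1.2, hx.2⟩, fun hx => ⟨⟨hx.2.2.ne, hx.1⟩, hx.2⟩⟩
  rw [← e, ← this, crossing]
  congr 1
  refine Finset.filter_congr fun j _ => and_congr_right fun hj => ?_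
  rw [Function.update_self, Function.update_of_ne hj.ne]

theorem nesting_update_self {F G : Finset α} {m g : α} (hm : ∀ x ∈ F, x < m) (hg : m < g)
    {φ : α → α} (h : φ ∈ partialBij F (G.erase g)) :
    nesting (Function.update φ m g) m = ((G.filter (m < ·)).filter (g < ·)).card := by
  have := card_filter_image_partialBij hm h (fun x => g < x) (fun x hx => hg.trans hx)
  rw [Finset.filter_filter]
  have e : (G.erase g).filter (fun x => g < x) = G.filter (fun x => m < x ∧ g < x) := by
    ext x
    simp only [Finset.mem_filter, Finset.mem_erase]
    exact ⟨fun hx => ⟨hx.1.2, hg.trans hx.2, hx.2⟩, fun hx => ⟨⟨hx.2.2.ne', hx.1⟩, hx.2.2⟩⟩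
  rw [← e, ← this, nesting]
  congr 1
  refine Finset.filter_congr fun j _ => and_congr_right fun hj => ?_
  rw [Function.update_self, Function.update_of_ne hj.ne]

/-- The weight generating function of the increasing bijections between two sets of the same size
factors over the starting points. -/
theorem sum_partialBij {R : Type*} [CommRing R] (w : α → ℕ → ℕ → R) (F G : Finset α)
    (hFG : F.card = G.card) :
    (∑ φ ∈ partialBij F G, ∏ i ∈ F,
        if i < φ i then w i (crossing φ i) (nesting φ i) else 0)
      = ∏ i ∈ F, diagSum (w i) ((G.filter (i < ·)).card - (F.filter (i < ·)).card) := by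
  -- The largest source is removed: its own statistics are ranks, and those of the smaller sources
  -- ignore it.
  induction F using Finset.induction_on_max generalizing G with
  | empty =>
    obtain rfl : G = ∅ := by simpa using hFG.symm
    have : partialBij (∅ : Finset α) ∅ = {id} := by
      ext φ
      rw [mem_partialBij, Finset.mem_singleton, funext_iff]
      simp
    simp [this]
  | insert m F hm ih =>
    have hmF : m ∉ F := fun h => lt_irrefl _ (hm m h)
    rw [Finset.card_insert_of_notMem hmF] at hFG
    have hFm : (insert m F).filter (m < ·) = ∅ := by
      rw [Finset.filter_eq_empty_iff]
      intro x hx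
      rcases Finset.mem_insert.1 hx with rfl | hx
      exacts [lt_irrefl _, (hm x hx).not_gt]
    rw [sum_partialBij_insert hmF, Finset.prod_insert hmF, hFm, Finset.card_empty, Nat.sub_zero,
      ← sum_rank_pair, Finset.sum_mul, Finset.sum_filter]
    refine Finset.sum_congr rfl fun g hg => ?_
    have hstep : ∀ φ ∈ partialBij F (G.erase g),
        (∏ i ∈ insert m F, if i < Function.update φ m g i then
          w i (crossing (Function.update φ m g) i) (nesting (Function.update φ m g) i) else 0)
        = (if m < g then w m ((G.filter (m < ·)).filter (· < g)).card
            ((G.filter (m < ·)).filter (g < ·)).card else 0)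
          * ∏ i ∈ F, if i < φ i then w i (crossing φ i) (nesting φ i) else 0 := by
      intro φ hφ
      rw [Finset.prod_insert hmF, Function.update_self]
      congr 1
      · split_ifs with hmg
        · rw [crossing_update_self hm hφ, nesting_update_self hm hmg hφ]
        · rfl
      · refine Finset.prod_congr rfl fun i hi => ?_
        rw [Function.update_of_ne (hm i hi).ne, crossing_update_of_lt (hm i hi),
          nesting_update_of_lt (hm i hi)]
    rw [Finset.sum_congr rfl hstep, ← Finset.mul_sum]
    split_ifs with hmg
    · rw [ih _ (by rw [Finset.card_erase_of_mem hg]; omega)]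
      congr 1
      refine Finset.prod_congr rfl fun i hi => ?_
      -- As `i < m < g`, deleting the arc from `m` to `g` lowers both the number of targets and the
      -- number of sources beyond `i` by one, so their difference is unchanged.
      have hig : g ∈ G.filter (i < ·) := Finset.mem_filter.2 ⟨hg, (hm i hi).trans hmg⟩
      have h1 : ((G.erase g).filter (i < ·)).card + 1 = (G.filter (i < ·)).card := by
        rw [Finset.filter_erase, Finset.card_erase_add_one hig]
      have h2 : ((insert m F).filter (i < ·)).card = (F.filter (i < ·)).card + 1 := by
        rw [Finset.filter_insert, if_pos (hm i hi), Finset.card_insert_of_notMem (by simp [hmF])]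
      rw [← h1, h2, Nat.add_sub_add_right]
    · rw [zero_mul]

/-- The order plays no part in membership, so reversing it converts results on upper arcs into
results on lower arcs. -/
theorem partialBij_orderDual (F G : Finset α) :
    @partialBij αᵒᵈ _ _ F G = @partialBij α _ _ F G :=
  Finset.ext fun φ =>
    (@mem_partialBij αᵒᵈ _ _ F G φ).trans (@mem_partialBij α _ _ F G φ).symm

/-- The number of arcs of `φ` that start after `i`, pass over it and cross the arc of `i`. -/
def lowerCrossing (φ : α → α) (i : α) : ℕ :=
  (Finset.univ.filter fun j => i < j ∧ φ j < i ∧ φ i < φ j).card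

/-- The number of arcs of `φ` that nest the lower arc starting at `i`. -/
def lowerNesting (φ : α → α) (i : α) : ℕ :=
  (Finset.univ.filter fun j => i < j ∧ φ j < φ i).card

theorem sum_partialBij_lower {R : Type*} [CommRing R] (w : α → ℕ → ℕ → R) (F G : Finset α)
    (hFG : F.card = G.card) :
    (∑ φ ∈ partialBij F G, ∏ i ∈ F,
        if φ i < i then w i (lowerCrossing φ i) (lowerNesting φ i) else 0)
      = ∏ i ∈ F, diagSum (w i) ((G.filter (· < i)).card - (F.filter (· < i)).card) := by
  have := sum_partialBij (α := αᵒᵈ) w F G hFG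
  rw [partialBij_orderDual] at this
  exact this

/-- Crossings at an upper arc involve upper arcs only, so they can be read off the upper half of a
permutation. -/
theorem crossing_congr {φ ψ : α → α} {i : α} (hi : i < φ i)
    (h : ∀ j, j < φ j ∨ j < ψ j → φ j = ψ j) : crossing φ i = crossing ψ i := by
  unfold crossing
  congr 1
  ext j
  simp only [Finset.mem_filter, Finset.mem_univ, true_and]
  rw [h i (Or.inl hi)]
  constructor
  · rintro ⟨h1, h2, h3⟩
    have e := h j (Or.inl (h1.trans h2))
    rw [e] at h2 h3
    exact ⟨h1, h2, h3⟩
  · rintro ⟨h1, h2, h3⟩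
    have e := h j (Or.inr (h1.trans h2))
    rw [← e] at h2 h3
    exact ⟨h1, h2, h3⟩

theorem nesting_congr {φ ψ : α → α} {i : α} (hi : i < φ i)
    (h : ∀ j, j < φ j ∨ j < ψ j → φ j = ψ j) : nesting φ i = nesting ψ i := by
  unfold nesting
  congr 1
  ext j
  simp only [Finset.mem_filter, Finset.mem_univ, true_and]
  have hi' := h i (Or.inl hi)
  constructor
  · rintro ⟨h1, h2⟩
    rw [h j (Or.inl (h1.trans (hi.trans h2))), hi'] at h2
    exact ⟨h1, h2⟩
  · rintro ⟨h1, h2⟩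
    rw [← h j (Or.inr (h1.trans ((hi' ▸ hi).trans h2))), ← hi'] at h2
    exact ⟨h1, h2⟩

theorem lowerCrossing_congr {φ ψ : α → α} {i : α} (hi : φ i < i)
    (h : ∀ j, φ j < j ∨ ψ j < j → φ j = ψ j) : lowerCrossing φ i = lowerCrossing ψ i :=
  crossing_congr (α := αᵒᵈ) hi h

theorem lowerNesting_congr {φ ψ : α → α} {i : α} (hi : φ i < i)
    (h : ∀ j, φ j < j ∨ ψ j < j → φ j = ψ j) : lowerNesting φ i = lowerNesting ψ i :=
  nesting_congr (α := αᵒᵈ) hi h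

end PartialBijections

end MasterJ

/-! ### Permutations as a type word with two bijections -/

namespace MasterJ

section PermutationTypes

variable {n : ℕ}

/-- The type of `i` in a permutation. -/
def permType (σ : Equiv.Perm (Fin n)) (i : Fin n) : Step :=
  if σ i = i then .fixed
  else if i < σ i then (if i < σ⁻¹ i then .val else .drise)
  else (if σ⁻¹ i < i then .peak else .dfall)

theorem permType_eq_of_iff {σ : Equiv.Perm (Fin n)} {i : Fin n} {s : Step}
    (h1 : i < σ i ↔ s = .val ∨ s = .drise) (h2 : σ⁻¹ i < i ↔ s = .peak ∨ s = .drise)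
    (h3 : σ i < i ↔ s = .peak ∨ s = .dfall) (h4 : i < σ⁻¹ i ↔ s = .val ∨ s = .dfall) :
    permType σ i = s := by
  have h5 : σ i = i ↔ s = .fixed := by
    have : σ i = i ↔ ¬ (i < σ i) ∧ ¬ (σ i < i) := by
      rw [not_lt, not_lt]
      exact ⟨fun h => ⟨h.le, h.ge⟩, fun h => le_antisymm h.1 h.2⟩
    rw [this, h1, h3]
    cases s <;> simp
  unfold permType
  simp only [h1, h2, h4, h5]
  cases s <;> simp

theorem inv_apply_lt_iff_of_apply_ne {σ : Equiv.Perm (Fin n)} {i : Fin n} (h : σ i ≠ i) :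
    ¬ (σ⁻¹ i < i) ↔ i < σ⁻¹ i := by
  have : σ⁻¹ i ≠ i := fun e => h (Equiv.Perm.inv_eq_iff_eq.1 e).symm
  exact ⟨fun h' => lt_of_le_of_ne (not_lt.1 h') this.symm, fun h' => h'.not_gt⟩

theorem permType_spec (σ : Equiv.Perm (Fin n)) (i : Fin n) :
    (permType σ i = .val ↔ i < σ⁻¹ i ∧ i < σ i) ∧ (permType σ i = .peak ↔ σ⁻¹ i < i ∧ σ i < i)
    ∧ (permType σ i = .dfall ↔ i < σ⁻¹ i ∧ σ i < i)
    ∧ (permType σ i = .drise ↔ σ⁻¹ i < i ∧ i < σ i) ∧ (permType σ i = .fixed ↔ σ i = i) := by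
  unfold permType
  have h0 : σ⁻¹ i = i ↔ σ i = i := by rw [Equiv.Perm.inv_eq_iff_eq, eq_comm]
  generalize σ⁻¹ i = k at h0
  generalize σ i = l at h0
  grind

theorem lt_apply_iff (σ : Equiv.Perm (Fin n)) (i : Fin n) :
    i < σ i ↔ permType σ i = .val ∨ permType σ i = .drise := by
  obtain ⟨h1, -, -, h2, -⟩ := permType_spec σ i
  rw [h1, h2, ← or_and_right]
  refine ⟨fun h => ⟨?_, h⟩, fun h => h.2⟩
  rw [← inv_apply_lt_iff_of_apply_ne h.ne']
  exact (em _).symm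

theorem apply_lt_iff (σ : Equiv.Perm (Fin n)) (i : Fin n) :
    σ i < i ↔ permType σ i = .peak ∨ permType σ i = .dfall := by
  obtain ⟨-, h1, h2, -⟩ := permType_spec σ i
  rw [h1, h2, ← or_and_right]
  refine ⟨fun h => ⟨?_, h⟩, fun h => h.2⟩
  rw [← inv_apply_lt_iff_of_apply_ne h.ne]
  exact em _

theorem lt_inv_apply_iff (σ : Equiv.Perm (Fin n)) (i : Fin n) :
    i < σ⁻¹ i ↔ permType σ i = .val ∨ permType σ i = .dfall := by
  obtain ⟨h1, -, h2, -⟩ := permType_spec σ i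
  rw [h1, h2, ← and_or_left]
  refine ⟨fun h => ⟨h, ?_⟩, fun h => h.1⟩
  exact lt_or_gt_of_ne fun e => h.ne (Equiv.Perm.eq_inv_iff_eq.2 e.symm)

theorem inv_apply_lt_iff (σ : Equiv.Perm (Fin n)) (i : Fin n) :
    σ⁻¹ i < i ↔ permType σ i = .peak ∨ permType σ i = .drise := by
  obtain ⟨-, h1, -, h2, -⟩ := permType_spec σ i
  rw [h1, h2, ← and_or_left]
  refine ⟨fun h => ⟨h, ?_⟩, fun h => h.1⟩
  exact lt_or_gt_of_ne fun e => h.ne (Equiv.Perm.inv_eq_iff_eq.2 e.symm)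

/-- The elements whose type is one of two given ones. -/
def ofTypes (τ : Fin n → Step) (s t : Step) : Finset (Fin n) :=
  Finset.univ.filter fun i => τ i = s ∨ τ i = t

theorem mem_ofTypes {τ : Fin n → Step} {s t : Step} {i : Fin n} :
    i ∈ ofTypes τ s t ↔ τ i = s ∨ τ i = t := by
  simp [ofTypes]

theorem card_filter_ofTypes (τ : Fin n → Step) {s t : Step} (hst : s ≠ t) (p : Fin n → Prop)
    [DecidablePred p] :
    ((ofTypes τ s t).filter p).card = (Finset.univ.filter fun j => p j ∧ τ j = s).card
      + (Finset.univ.filter fun j => p j ∧ τ j = t).card := by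
  rw [← Finset.card_union_of_disjoint]
  · congr 1
    ext j
    simp only [mem_ofTypes, Finset.mem_filter, Finset.mem_union, Finset.mem_univ, true_and]
    tauto
  · rw [Finset.disjoint_left]
    intro j hj hj'
    rw [Finset.mem_filter] at hj hj'
    exact hst (hj.2.2.symm.trans hj'.2.2)

theorem restrict_mem_partialBij {σ : Equiv.Perm (Fin n)} {F G : Finset (Fin n)}
    (h : ∀ i, i ∈ F ↔ σ i ∈ G) :
    (fun x => if x ∈ F then σ x else x) ∈ partialBij F G := by
  refine mem_partialBij.2 ⟨⟨?_, ?_, ?_⟩, ?_⟩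
  · intro x hx
    have hx' : x ∈ F := hx
    simpa [hx'] using (h x).1 hx'
  · intro x hx y hy e
    have hx' : x ∈ F := hx
    have hy' : y ∈ F := hy
    simpa [hx', hy'] using e
  · intro y hy
    have : σ⁻¹ y ∈ F := by rw [h]; simpa using hy
    exact ⟨σ⁻¹ y, this, (if_pos this).trans (σ.apply_symm_apply y)⟩
  · intro x hx
    simp [hx]

theorem sum_prod_ite_zero {ι κ R : Type*} [CommRing R] (S : Finset ι) (F : Finset κ)
    (p : ι → κ → Prop) [∀ x, DecidablePred (p x)] (f : ι → κ → R) :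
    (∑ x ∈ S, ∏ i ∈ F, if p x i then f x i else 0)
      = ∑ x ∈ S with ∀ i ∈ F, p x i, ∏ i ∈ F, f x i := by
  rw [Finset.sum_filter]
  refine Finset.sum_congr rfl fun x _ => ?_
  rw [Finset.prod_ite_zero]

/-- The permutations of a given type are the pairs of an increasing and a decreasing bijection. -/
theorem sum_permType {R : Type*} [CommRing R] (w v : Fin n → ℕ → ℕ → R) (τ : Fin n → Step) :
    (∑ σ : Equiv.Perm (Fin n) with permType σ = τ,
      (∏ i ∈ ofTypes τ .val .drise, w i (crossing σ i) (nesting σ i))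
        * ∏ i ∈ ofTypes τ .peak .dfall, v i (lowerCrossing σ i) (lowerNesting σ i))
    = (∑ φ ∈ partialBij (ofTypes τ .val .drise) (ofTypes τ .peak .drise),
        ∏ i ∈ ofTypes τ .val .drise, if i < φ i then w i (crossing φ i) (nesting φ i) else 0)
      * ∑ φ ∈ partialBij (ofTypes τ .peak .dfall) (ofTypes τ .val .dfall),
        ∏ i ∈ ofTypes τ .peak .dfall,
          if φ i < i then v i (lowerCrossing φ i) (lowerNesting φ i) else 0 := by
  rw [sum_prod_ite_zero, sum_prod_ite_zero, Finset.sum_mul_sum, ← Finset.sum_product']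
  set F := ofTypes τ .val .drise with hF
  set A := ofTypes τ .peak .dfall with hA
  have hFA : ∀ i, i ∈ F → i ∉ A := by
    intro i hi hi'
    rw [hF, mem_ofTypes] at hi
    rw [hA, mem_ofTypes] at hi'
    rcases hi with h | h <;> simp [h] at hi'
  have memF : ∀ {σ : Equiv.Perm (Fin n)}, permType σ = τ → ∀ i, i ∈ F ↔ i < σ i := by
    rintro σ rfl i
    rw [hF, mem_ofTypes, lt_apply_iff]
  have memA : ∀ {σ : Equiv.Perm (Fin n)}, permType σ = τ → ∀ i, i ∈ A ↔ σ i < i := by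
    rintro σ rfl i
    rw [hA, mem_ofTypes, apply_lt_iff]
  refine Finset.sum_bij
    (fun σ _ => (fun x => if x ∈ F then σ x else x, fun x => if x ∈ A then σ x else x)) ?_ ?_ ?_ ?_
  · intro σ hσ
    have hσ' : permType σ = τ := by simpa using hσ
    have hF' := memF hσ'
    have hA' := memA hσ'
    simp only [Finset.mem_product, Finset.mem_filter]
    refine ⟨⟨restrict_mem_partialBij fun i => ?_, fun i hi => ?_⟩,
      ⟨restrict_mem_partialBij fun i => ?_, fun i hi => ?_⟩⟩
    · rw [hF', mem_ofTypes, ← hσ', ← inv_apply_lt_iff]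
      simp
    · simpa [hi] using (hF' i).1 hi
    · rw [hA', mem_ofTypes, ← hσ', ← lt_inv_apply_iff]
      simp
    · simpa [hi] using (hA' i).1 hi
  · intro σ hσ ρ hρ e
    have hσ' : permType σ = τ := by simpa using hσ
    have hρ' : permType ρ = τ := by simpa using hρ
    rw [Prod.mk.injEq] at e
    ext1 x
    by_cases hxF : x ∈ F
    · simpa [hxF] using congrFun e.1 x
    by_cases hxA : x ∈ A
    · simpa [hxA] using congrFun e.2 x
    have h1 := hxF
    have h2 := hxA
    rw [memF hσ', not_lt] at hxF
    rw [memA hσ', not_lt] at hxA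
    rw [memF hρ', not_lt] at h1
    rw [memA hρ', not_lt] at h2
    exact (le_antisymm hxF hxA).trans (le_antisymm h1 h2).symm
  · rintro ⟨φ, ψ⟩ h
    simp only [Finset.mem_product, Finset.mem_filter] at h
    obtain ⟨⟨hφ, hφF⟩, hψ, hψA⟩ := h
    obtain ⟨hφb, hφid⟩ := mem_partialBij.1 hφ
    obtain ⟨hψb, hψid⟩ := mem_partialBij.1 hψ
    have hG : ∀ x ∈ F, τ (φ x) = .peak ∨ τ (φ x) = .drise := fun x hx =>
      mem_ofTypes.1 (hφb.mapsTo hx)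
    have hG' : ∀ x ∈ A, τ (ψ x) = .val ∨ τ (ψ x) = .dfall := fun x hx =>
      mem_ofTypes.1 (hψb.mapsTo hx)
    have hX : ∀ x, x ∉ F → x ∉ A → τ x = .fixed := by
      intro x h1 h2
      rw [hF, mem_ofTypes] at h1
      rw [hA, mem_ofTypes] at h2
      cases h : τ x <;> simp [h] at h1 h2 ⊢
    -- Off `A` the map `ψ` is the identity, so the second branch also covers the fixed points.
    let f : Fin n → Fin n := fun x => if x ∈ F then φ x else ψ x
    have fF : ∀ x ∈ F, f x = φ x := fun x hx => if_pos hx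
    have fA : ∀ x ∈ A, f x = ψ x := fun x hx => if_neg fun h => hFA x h hx
    have fX : ∀ x, x ∉ F → x ∉ A → f x = x := fun x h1 h2 => by
      simp only [f, if_neg h1, hψid x h2]
    -- The images of `F`, of `A` and of the remaining points have disjoint sets of types, so a
    -- collision can only occur within one class.
    have hinj : Function.Injective f := by
      intro x y e
      by_cases hx : x ∈ F
      · rw [fF x hx] at e
        have hx' := hG x hx
        rw [e] at hx'
        by_cases hy : y ∈ F
        · rw [fF y hy] at e
          exact hφb.injOn hx hy e
        by_cases hy' : y ∈ A
        · rw [fA y hy'] at hx'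
          rcases hG' y hy' with h | h <;> simp [h] at hx'
        · rw [fX y hy hy', hX y hy hy'] at hx'
          simp at hx'
      by_cases hx1 : x ∈ A
      · rw [fA x hx1] at e
        have hx' := hG' x hx1
        rw [e] at hx'
        by_cases hy : y ∈ F
        · rw [fF y hy] at hx'
          rcases hG y hy with h | h <;> simp [h] at hx'
        by_cases hy' : y ∈ A
        · rw [fA y hy'] at e
          exact hψb.injOn hx1 hy' e
        · rw [fX y hy hy', hX y hy hy'] at hx'
          simp at hx'
      · have hx' := hX x hx hx1
        rw [fX x hx hx1] at e
        rw [e] at hx'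
        by_cases hy : y ∈ F
        · rw [fF y hy] at hx'
          rcases hG y hy with h | h <;> simp [h] at hx'
        by_cases hy' : y ∈ A
        · rw [fA y hy'] at hx'
          rcases hG' y hy' with h | h <;> simp [h] at hx'
        · rwa [fX y hy hy'] at e
    let σ : Equiv.Perm (Fin n) := Equiv.ofBijective f (Finite.injective_iff_bijective.1 hinj)
    have hσ : ∀ x, σ x = f x := fun x => rfl
    have hinv : ∀ x, σ⁻¹ (f x) = x := fun x => by
      rw [Equiv.Perm.inv_eq_iff_eq, hσ]
    -- Comparing `i` with `σ i` uses `i` as a source; comparing it with `σ⁻¹ i` uses it as a target.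
    have htype : permType σ = τ := by
      funext i
      have hout : (i < σ i ↔ τ i = .val ∨ τ i = .drise)
          ∧ (σ i < i ↔ τ i = .peak ∨ τ i = .dfall) := by
        rw [← mem_ofTypes, ← mem_ofTypes, ← hF, ← hA, hσ]
        by_cases hi : i ∈ F
        · have := hφF i hi
          simp [fF i hi, hi, this, this.not_gt, hFA i hi]
        by_cases hi' : i ∈ A
        · have := hψA i hi'
          simp [fA i hi', hi, this, this.not_gt, hi']
        · simp [fX i hi hi', hi, hi']
      have hin : (σ⁻¹ i < i ↔ τ i = .peak ∨ τ i = .drise)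
          ∧ (i < σ⁻¹ i ↔ τ i = .val ∨ τ i = .dfall) := by
        obtain ⟨x, rfl⟩ := (Finite.injective_iff_bijective.1 hinj).2 i
        rw [hinv]
        by_cases hx : x ∈ F
        · have := hφF x hx
          rw [fF x hx]
          rcases hG x hx with h | h <;> simp [h, this, this.le]
        by_cases hx' : x ∈ A
        · have := hψA x hx'
          rw [fA x hx']
          rcases hG' x hx' with h | h <;> simp [h, this, this.le]
        · simp [fX x hx hx', hX x hx hx']
      exact permType_eq_of_iff hout.1 hin.1 hout.2 hin.2
    refine ⟨σ, by simp [htype], ?_⟩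
    rw [Prod.mk.injEq]
    constructor <;> funext x
    · by_cases hx : x ∈ F
      · simp [hx, hσ, fF]
      · simp [hx, hφid]
    · by_cases hx : x ∈ A
      · simp [hx, hσ, fA]
      · simp [hx, hψid]
  · intro σ hσ
    have hσ' : permType σ = τ := by simpa using hσ
    have hF' := memF hσ'
    have hA' := memA hσ'
    have hup : ∀ j, (j < σ j ∨ j < if j ∈ F then σ j else j) →
        σ j = if j ∈ F then σ j else j := by
      intro j hj
      by_cases h : j ∈ F
      · simp [h]
      · simp only [h, if_false, lt_irrefl, or_false] at hj
        exact absurd ((hF' j).2 hj) h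
    have hdown : ∀ j, (σ j < j ∨ (if j ∈ A then σ j else j) < j) →
        σ j = if j ∈ A then σ j else j := by
      intro j hj
      by_cases h : j ∈ A
      · simp [h]
      · simp only [h, if_false, lt_irrefl, or_false] at hj
        exact absurd ((hA' j).2 hj) h
    congr 1
    · refine Finset.prod_congr rfl fun i hi => ?_
      have hi' := (hF' i).1 hi
      rw [crossing_congr (ψ := fun x => if x ∈ F then σ x else x) hi' hup,
        nesting_congr (ψ := fun x => if x ∈ F then σ x else x) hi' hup]
    · refine Finset.prod_congr rfl fun i hi => ?_
      have hi' := (hA' i).1 hi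
      rw [lowerCrossing_congr (ψ := fun x => if x ∈ A then σ x else x) hi' hdown,
        lowerNesting_congr (ψ := fun x => if x ∈ A then σ x else x) hi' hdown]

end PermutationTypes

end MasterJ

/-! ### From permutations to weighted paths -/

namespace MasterJ

section MasterSum

variable {n : ℕ}

theorem ucross_eq_crossing (σ : Equiv.Perm (Fin n)) (i : Fin n) : ucross i σ = crossing σ i := by
  refine Finset.card_bij' (fun q _ => q.1) (fun j _ => (j, σ j, σ i)) ?_ ?_ ?_ ?_
  · rintro ⟨x, y, z⟩ hq
    simp only [Finset.mem_filter, Finset.mem_univ, true_and] at hq ⊢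
    obtain ⟨h1, h2, h3, rfl, rfl⟩ := hq
    exact ⟨h1, h2, h3⟩
  · intro j hj
    simpa using hj
  · rintro ⟨x, y, z⟩ hq
    simp only [Finset.mem_filter, Finset.mem_univ, true_and] at hq
    obtain ⟨-, -, -, rfl, rfl⟩ := hq
    rfl
  · intro j _
    rfl

theorem unest_eq_nesting {σ : Equiv.Perm (Fin n)} {i : Fin n} (hi : i < σ i) :
    unest i σ = nesting σ i := by
  refine Finset.card_bij' (fun q _ => q.1) (fun j _ => (j, σ i, σ j)) ?_ ?_ ?_ ?_
  · rintro ⟨x, y, z⟩ hq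
    simp only [Finset.mem_filter, Finset.mem_univ, true_and] at hq
    obtain ⟨h1, -, h3, rfl, rfl⟩ := hq
    refine Finset.mem_filter.2 ⟨Finset.mem_univ _, ?_⟩
    exact ⟨h1, h3⟩
  · intro j hj
    simpa [hi] using hj
  · rintro ⟨x, y, z⟩ hq
    simp only [Finset.mem_filter, Finset.mem_univ, true_and] at hq
    obtain ⟨-, -, -, rfl, rfl⟩ := hq
    rfl
  · intro j _
    rfl

theorem lcross_eq_lowerCrossing (σ : Equiv.Perm (Fin n)) (k : Fin n) :
    lcross k σ = lowerCrossing σ k := by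
  refine Finset.card_bij' (fun q _ => q.2.2) (fun j _ => (σ k, σ j, j)) ?_ ?_ ?_ ?_
  · rintro ⟨x, y, z⟩ hq
    simp only [Finset.mem_filter, Finset.mem_univ, true_and] at hq ⊢
    obtain ⟨h1, h2, h3, rfl, rfl⟩ := hq
    exact ⟨h3, h2, h1⟩
  · intro j hj
    simp only [Finset.mem_filter, Finset.mem_univ, true_and] at hj
    refine Finset.mem_filter.2 ⟨Finset.mem_univ _, ?_⟩
    exact ⟨hj.2.2, hj.2.1, hj.1, rfl, rfl⟩
  · rintro ⟨x, y, z⟩ hq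
    simp only [Finset.mem_filter, Finset.mem_univ, true_and] at hq
    obtain ⟨-, -, -, rfl, rfl⟩ := hq
    rfl
  · intro j _
    rfl

theorem lnest_eq_lowerNesting {σ : Equiv.Perm (Fin n)} {k : Fin n} (hk : σ k < k) :
    lnest k σ = lowerNesting σ k := by
  refine Finset.card_bij' (fun q _ => q.2.2) (fun j _ => (σ j, σ k, j)) ?_ ?_ ?_ ?_
  · rintro ⟨x, y, z⟩ hq
    simp only [Finset.mem_filter, Finset.mem_univ, true_and] at hq
    obtain ⟨h1, -, h3, rfl, rfl⟩ := hq
    refine Finset.mem_filter.2 ⟨Finset.mem_univ _, ?_⟩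
    exact ⟨h3, h1⟩
  · intro j hj
    simp only [Finset.mem_filter, Finset.mem_univ, true_and] at hj
    refine Finset.mem_filter.2 ⟨Finset.mem_univ _, ?_⟩
    exact ⟨hj.2, hk, hj.1, rfl, rfl⟩
  · rintro ⟨x, y, z⟩ hq
    simp only [Finset.mem_filter, Finset.mem_univ, true_and] at hq
    obtain ⟨-, -, -, rfl, rfl⟩ := hq
    rfl
  · intro j _
    rfl

/-- Among the upper arcs starting before `i`, discard those ending before `i`; none ends at `i`,
which is fixed. Double rises count once as source and once as target, and cancel. -/
theorem psnest_eq {σ : Equiv.Perm (Fin n)} {i : Fin n} (hi : σ i = i) :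
    psnest i σ = (Finset.univ.filter fun j => j < i ∧ permType σ j = .val).card
      - (Finset.univ.filter fun j => j < i ∧ permType σ j = .peak).card := by
  have h1 := card_filter_ofTypes (permType σ) (s := .val) (t := .drise) (by decide) (· < i)
  have h2 := card_filter_ofTypes (permType σ) (s := .peak) (t := .drise) (by decide) (· < i)
  have h3 := Finset.card_filter_add_card_filter_not
    (s := (ofTypes (permType σ) .val .drise).filter (· < i)) (fun j => σ j < i)
  have h4 : (((ofTypes (permType σ) .val .drise).filter (· < i)).filter fun j => σ j < i).card
      = ((ofTypes (permType σ) .peak .drise).filter (· < i)).card := by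
    refine Finset.card_bij (fun j _ => σ j) ?_ (fun _ _ _ _ e => σ.injective e) ?_
    · intro j hj
      simp only [Finset.mem_filter, mem_ofTypes, ← lt_apply_iff, ← inv_apply_lt_iff] at hj ⊢
      exact ⟨(Equiv.Perm.inv_eq_iff_eq.2 rfl : σ⁻¹ (σ j) = j).trans_lt hj.1.1, hj.2⟩
    · intro y hy
      obtain ⟨x, rfl⟩ := σ.surjective y
      simp only [Finset.mem_filter, mem_ofTypes, ← inv_apply_lt_iff] at hy
      have hx : x < σ x := (Equiv.Perm.inv_eq_iff_eq.2 rfl : σ⁻¹ (σ x) = x).symm.trans_lt hy.1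
      refine ⟨x, ?_, rfl⟩
      simp only [Finset.mem_filter, mem_ofTypes, ← lt_apply_iff]
      exact ⟨⟨hx, hx.trans hy.2⟩, hy.2⟩
  have h5 : (((ofTypes (permType σ) .val .drise).filter (· < i)).filter fun j => ¬ σ j < i).card
      = psnest i σ := by
    unfold psnest
    congr 1
    ext j
    simp only [Finset.mem_filter, mem_ofTypes, ← lt_apply_iff, Finset.mem_univ, true_and, not_lt]
    constructor
    · rintro ⟨⟨-, h⟩, h'⟩
      exact ⟨h, lt_of_le_of_ne h' fun e => h.ne (σ.injective (e.symm.trans hi.symm))⟩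
    · rintro ⟨h, h'⟩
      exact ⟨⟨h.trans h', h⟩, h'.le⟩
  omega

/-- The weight of a permutation in `masterP`, without the cycle count. -/
def permWeight {R : Type*} [CommRing R] (a b c d : ℕ → ℕ → R) (e : ℕ → R)
    (σ : Equiv.Perm (Fin n)) : R :=
  (∏ i ∈ Cval σ, a (ucross i σ) (unest i σ))
    * (∏ i ∈ Cpeak σ, b (lcross i σ) (lnest i σ))
    * (∏ i ∈ Cdfall σ, c (lcross i σ) (lnest i σ))
    * (∏ i ∈ Cdrise σ, d (ucross i σ) (unest i σ))
    * (∏ i ∈ Fix σ, e (psnest i σ))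

theorem Cval_eq (σ : Equiv.Perm (Fin n)) :
    Cval σ = Finset.univ.filter fun i => permType σ i = .val :=
  Finset.filter_congr fun i _ => (permType_spec σ i).1.symm

theorem Cpeak_eq (σ : Equiv.Perm (Fin n)) :
    Cpeak σ = Finset.univ.filter fun i => permType σ i = .peak :=
  Finset.filter_congr fun i _ => (permType_spec σ i).2.1.symm

theorem Cdfall_eq (σ : Equiv.Perm (Fin n)) :
    Cdfall σ = Finset.univ.filter fun i => permType σ i = .dfall :=
  Finset.filter_congr fun i _ => (permType_spec σ i).2.2.1.symm

theorem Cdrise_eq (σ : Equiv.Perm (Fin n)) :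
    Cdrise σ = Finset.univ.filter fun i => permType σ i = .drise :=
  Finset.filter_congr fun i _ => (permType_spec σ i).2.2.2.1.symm

theorem Fix_eq (σ : Equiv.Perm (Fin n)) :
    Fix σ = Finset.univ.filter fun i => permType σ i = .fixed :=
  Finset.filter_congr fun i _ => (permType_spec σ i).2.2.2.2.symm

theorem permWeight_eq {R : Type*} [CommRing R] (a b c d : ℕ → ℕ → R) (e : ℕ → R)
    (σ : Equiv.Perm (Fin n)) :
    permWeight a b c d e σ
      = (∏ i ∈ ofTypes (permType σ) .val .drise,
          (if permType σ i = .val then a else d) (crossing σ i) (nesting σ i))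
        * (∏ i ∈ ofTypes (permType σ) .peak .dfall,
          (if permType σ i = .peak then b else c) (lowerCrossing σ i) (lowerNesting σ i))
        * ∏ i with permType σ i = .fixed,
          e ((Finset.univ.filter fun j => j < i ∧ permType σ j = .val).card
            - (Finset.univ.filter fun j => j < i ∧ permType σ j = .peak).card) := by
  simp only [permWeight, Cval_eq, Cpeak_eq, Cdfall_eq, Cdrise_eq, Fix_eq, ofTypes,
    Finset.prod_filter, ← Finset.prod_mul_distrib]
  refine Finset.prod_congr rfl fun i _ => ?_
  have hup := lt_apply_iff σ i
  have hdown := apply_lt_iff σ i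
  have hfix := (permType_spec σ i).2.2.2.2
  rw [ucross_eq_crossing, lcross_eq_lowerCrossing]
  cases h : permType σ i <;> simp only [h, reduceCtorEq, if_true, if_false, or_true, or_false,
    iff_true, true_iff, one_mul, mul_one] at hup hdown hfix ⊢
  · rw [unest_eq_nesting hup]
  · rw [lnest_eq_lowerNesting hdown]
  · rw [lnest_eq_lowerNesting hdown]
  · rw [unest_eq_nesting hup]
  · rw [psnest_eq hfix]

theorem prod_ofTypes {R : Type*} [CommRing R] (τ : Fin n → Step) (s t : Step) (f : Fin n → R) :
    ∏ i ∈ ofTypes τ s t, f i = ∏ i, if τ i = s ∨ τ i = t then f i else 1 :=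
  Finset.prod_filter _ _

theorem sum_permWeight_permType {R : Type*} [CommRing R] (a b c d : ℕ → ℕ → R) (e : ℕ → R)
    (τ : Fin n → Step) :
    (∑ σ : Equiv.Perm (Fin n) with permType σ = τ, permWeight a b c d e σ)
      = if 0 + (Finset.univ.filter fun i => τ i = .val).card
          = (Finset.univ.filter fun i => τ i = .peak).card then
        ∏ i, stepWeight (diagSum a) (diagSum b) (diagSum c) (diagSum d) e
          (0 + (Finset.univ.filter fun j => j < i ∧ τ j = .val).card)
          (Finset.univ.filter fun j => j < i ∧ τ j = .peak).card (τ i)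
      else 0 := by
  have hsum : (∑ σ : Equiv.Perm (Fin n) with permType σ = τ, permWeight a b c d e σ)
      = (∑ σ : Equiv.Perm (Fin n) with permType σ = τ,
          (∏ i ∈ ofTypes τ .val .drise,
            (if τ i = .val then a else d) (crossing σ i) (nesting σ i))
          * ∏ i ∈ ofTypes τ .peak .dfall,
            (if τ i = .peak then b else c) (lowerCrossing σ i) (lowerNesting σ i))
        * ∏ i with τ i = .fixed,
          e ((Finset.univ.filter fun j => j < i ∧ τ j = .val).card
            - (Finset.univ.filter fun j => j < i ∧ τ j = .peak).card) := by
    rw [Finset.sum_mul]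
    refine Finset.sum_congr rfl fun σ hσ => ?_
    obtain rfl : permType σ = τ := by simpa using hσ
    exact permWeight_eq a b c d e σ
  rw [hsum, sum_permType (fun i => if τ i = .val then a else d)
    (fun i => if τ i = .peak then b else c)]
  have card : ∀ s t : Step, s ≠ t → (ofTypes τ s t).card
      = (Finset.univ.filter fun i => τ i = s).card
        + (Finset.univ.filter fun i => τ i = t).card := by
    intro s t hst
    simpa using card_filter_ofTypes τ hst fun _ => True
  split_ifs with hcard
  · rw [sum_partialBij _ _ _ (by
        rw [card _ _ (by decide), card _ _ (by decide)]; omega),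
      sum_partialBij_lower _ _ _ (by
        rw [card _ _ (by decide), card _ _ (by decide)]; omega)]
    rw [prod_ofTypes, prod_ofTypes, Finset.prod_filter, ← Finset.prod_mul_distrib,
      ← Finset.prod_mul_distrib]
    refine Finset.prod_congr rfl fun i _ => ?_
    -- Upper arcs give counts after `i`, whereas heights count steps before `i`. Equality of the
    -- totals converts one into the other; the final summand accounts for the `+ 1` at valleys.
    have hsplit : ∀ s : Step, (Finset.univ.filter fun j => τ j = s).card
        = (Finset.univ.filter fun j => j < i ∧ τ j = s).card
          + (Finset.univ.filter fun j => i < j ∧ τ j = s).card + if τ i = s then 1 else 0 := by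
      intro s
      simp only [Finset.card_filter]
      rw [← Fintype.sum_ite_eq i fun j => if τ j = s then 1 else 0, ← Finset.sum_add_distrib,
        ← Finset.sum_add_distrib]
      refine Finset.sum_congr rfl fun j _ => ?_
      rcases lt_trichotomy i j with h | h | h
      · simp [h, h.not_gt, h.ne]
      · simp [h]
      · simp [h, h.not_gt, h.ne']
    have hv := hsplit .val
    have hp := hsplit .peak
    rw [card_filter_ofTypes τ (by decide), card_filter_ofTypes τ (by decide),
      card_filter_ofTypes τ (by decide), card_filter_ofTypes τ (by decide)]
    cases h : τ i <;> simp only [h, reduceCtorEq, if_true, if_false, or_true, or_false,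
      one_mul, mul_one, stepWeight] at hv hp ⊢
    all_goals
      congr 1
      omega
  · have hempty : partialBij (ofTypes τ .val .drise) (ofTypes τ .peak .drise) = ∅ := by
      rw [Finset.eq_empty_iff_forall_notMem]
      intro φ hφ
      have := card_eq_of_mem_partialBij hφ
      rw [card _ _ (by decide), card _ _ (by decide)] at this
      omega
    rw [hempty, Finset.sum_empty, zero_mul, zero_mul]

theorem sum_permWeight {R : Type*} [CommRing R] (a b c d : ℕ → ℕ → R) (e : ℕ → R) (n : ℕ) :
    ∑ σ : Equiv.Perm (Fin n), permWeight a b c d e σ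
      = pathSum (diagSum a) (diagSum b) (diagSum c) (diagSum d) e 0 n := by
  rw [← Finset.sum_fiberwise Finset.univ permType, pathSum]
  exact Finset.sum_congr rfl fun τ _ => sum_permWeight_permType a b c d e τ

end MasterSum

end MasterJ

/-! ### The sign as a product of local factors -/

namespace MasterJ

section Sign

variable {n : ℕ}

theorem neg_one_pow_cyc (σ : Equiv.Perm (Fin n)) :
    (-1 : ℤ) ^ cyc σ = (-1) ^ n * (Equiv.Perm.sign σ : ℤ) := by
  have hle : σ.support.card ≤ n := by simpa using Finset.card_le_univ σ.support
  rw [cyc, Equiv.Perm.parts_partition, Equiv.Perm.sign_of_cycleType, Equiv.Perm.sum_cycleType]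
  simp only [Multiset.card_add, Multiset.card_replicate, Fintype.card_fin, Units.val_pow_eq_pow_val,
    Units.val_neg, Units.val_one]
  rw [← pow_add]
  obtain ⟨k, hk⟩ := Nat.exists_eq_add_of_le hle
  have e1 : n - σ.support.card = k := by omega
  have e2 : n + (σ.support.card + σ.cycleType.card)
      = σ.cycleType.card + k + 2 * σ.support.card := by omega
  rw [e1, e2, pow_add _ _ (2 * _), pow_mul]
  simp

/-- Taken at every `i`, not only at upper arcs, `nesting` counts the inversions whose later position
is `i`. -/
theorem sign_eq_neg_one_pow_sum_nesting (σ : Equiv.Perm (Fin n)) :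
    (Equiv.Perm.sign σ : ℤ) = (-1) ^ ∑ i, nesting σ i := by
  rw [Equiv.Perm.sign_eq_prod_prod_Iio, ← Finset.prod_pow_eq_pow_sum, Units.coe_prod]
  refine Finset.prod_congr rfl fun i _ => ?_
  rw [Units.coe_prod, nesting, ← Finset.prod_const, Finset.prod_filter]
  have : Finset.Iio i = Finset.univ.filter (· < i) := by ext; simp
  rw [this, Finset.prod_filter]
  refine Finset.prod_congr rfl fun j _ => ?_
  by_cases hj : j < i
  · rcases lt_or_gt_of_ne (σ.injective.ne hj.ne) with h | h
    · simp [hj, h, h.not_gt]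
    · simp [hj, h, h.not_gt]
  · simp [hj]

theorem card_filter_split {α : Type*} [Fintype α] (p q : α → Prop) [DecidablePred p]
    [DecidablePred q] :
    (Finset.univ.filter p).card = (Finset.univ.filter fun j => p j ∧ q j).card
      + (Finset.univ.filter fun j => p j ∧ ¬ q j).card := by
  rw [← Finset.filter_filter, ← Finset.filter_filter, Finset.card_filter_add_card_filter_not]

theorem card_filter_lt (i : Fin n) : (Finset.univ.filter fun j => j < i).card = i := by
  have : (Finset.univ.filter fun j => j < i) = Finset.Iio i := by ext; simp
  rw [this, Fin.card_Iio]

theorem card_filter_apply_lt (σ : Equiv.Perm (Fin n)) (i : Fin n) :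
    (Finset.univ.filter fun j => σ j < i).card = i := by
  rw [← card_filter_lt i]
  refine Finset.card_bij (fun j _ => σ j) ?_ (fun _ _ _ _ e => σ.injective e) ?_
  · intro j hj
    simpa using hj
  · intro j hj
    exact ⟨σ.symm j, by simpa using hj, by simp⟩

/-- The sets `{j < i}` and `{σ j < σ i}` have `i` and `σ i` elements; removing their common part
leaves the two nesting counts. -/
theorem nesting_add_apply (σ : Equiv.Perm (Fin n)) (i : Fin n) :
    nesting σ i + (σ i : ℕ) = lowerNesting σ i + (i : ℕ) := by
  have h1 := card_filter_split (fun j => j < i) (fun j => σ j < σ i)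
  have h2 := card_filter_split (fun j => σ j < σ i) (fun j => j < i)
  rw [card_filter_lt] at h1
  rw [card_filter_apply_lt] at h2
  have h3 : (Finset.univ.filter fun j => σ j < σ i ∧ j < i)
      = Finset.univ.filter fun j => j < i ∧ σ j < σ i := Finset.filter_congr fun j _ => and_comm
  have h4 : (Finset.univ.filter fun j => j < i ∧ ¬ σ j < σ i).card = nesting σ i := by
    rw [nesting]
    congr 1
    refine Finset.filter_congr fun j _ => and_congr_right fun hj => ?_
    rw [not_lt]
    exact (σ.injective.ne hj.ne').le_iff_lt
  have h5 : (Finset.univ.filter fun j => σ j < σ i ∧ ¬ j < i).card = lowerNesting σ i := by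
    rw [lowerNesting]
    congr 1
    refine Finset.filter_congr fun j _ => ?_
    rw [and_comm]
    refine and_congr_left fun hj => ?_
    rw [not_lt]
    exact Ne.le_iff_lt fun e => hj.ne (by rw [e])
  rw [h3] at h2
  omega

/-- The number of upper arcs passing strictly over `i`. -/
def upperArcs (σ : Equiv.Perm (Fin n)) (i : Fin n) : ℕ :=
  (Finset.univ.filter fun j => j < i ∧ i < σ j).card

/-- The number of lower arcs passing strictly under `i`. -/
def lowerArcs (σ : Equiv.Perm (Fin n)) (i : Fin n) : ℕ :=
  (Finset.univ.filter fun j => i < j ∧ σ j < i).card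

/-- The sets `{j < i}` and `{σ j < i}` have equal size. Outside their common part lie the arcs
passing `i`, and possibly one arc ending or starting at `i`. -/
theorem upperArcs_balance (σ : Equiv.Perm (Fin n)) (i : Fin n) :
    upperArcs σ i + (if σ⁻¹ i < i then 1 else 0) = lowerArcs σ i + if σ i < i then 1 else 0 := by
  have h1 := card_filter_split (fun j => j < i) (fun j => σ j < i)
  have h2 := card_filter_split (fun j => σ j < i) (fun j => j < i)
  rw [card_filter_lt] at h1
  rw [card_filter_apply_lt] at h2
  have h3 : (Finset.univ.filter fun j => σ j < i ∧ j < i)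
      = Finset.univ.filter fun j => j < i ∧ σ j < i := Finset.filter_congr fun j _ => and_comm
  have h4 : (Finset.univ.filter fun j => j < i ∧ ¬ σ j < i).card
      = upperArcs σ i + if σ⁻¹ i < i then 1 else 0 := by
    rw [card_filter_split _ fun j => σ⁻¹ i ≠ j, upperArcs]
    congr 1
    · congr 1
      refine Finset.filter_congr fun j _ => ?_
      rw [and_assoc, not_lt, ne_eq, Equiv.Perm.inv_eq_iff_eq]
      refine and_congr_right fun _ => ?_
      rw [lt_iff_le_and_ne]
    · have : (Finset.univ.filter fun j => (j < i ∧ ¬ σ j < i) ∧ ¬ σ⁻¹ i ≠ j)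
          = if σ⁻¹ i < i then {σ⁻¹ i} else ∅ := by
        ext j
        rw [Finset.mem_filter, not_not]
        split_ifs with h
        · rw [Finset.mem_singleton]
          refine ⟨fun hj => hj.2.2.symm, ?_⟩
          rintro rfl
          refine ⟨Finset.mem_univ _, ⟨h, ?_⟩, rfl⟩
          rw [show σ (σ⁻¹ i) = i from σ.apply_symm_apply i]
          exact lt_irrefl i
        · simp only [Finset.notMem_empty, iff_false]
          rintro ⟨-, ⟨hj, -⟩, rfl⟩
          exact h hj
      rw [this]
      split_ifs <;> simp
  have h5 : (Finset.univ.filter fun j => σ j < i ∧ ¬ j < i).card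
      = lowerArcs σ i + if σ i < i then 1 else 0 := by
    rw [card_filter_split _ fun j => i ≠ j, lowerArcs]
    congr 1
    · congr 1
      refine Finset.filter_congr fun j _ => ?_
      rw [and_assoc, not_lt, ← lt_iff_le_and_ne, and_comm]
    · have : (Finset.univ.filter fun j => (σ j < i ∧ ¬ j < i) ∧ ¬ i ≠ j)
          = if σ i < i then {i} else ∅ := by
        ext j
        rw [Finset.mem_filter, not_not]
        split_ifs with h
        · rw [Finset.mem_singleton]
          refine ⟨fun hj => hj.2.2.symm, ?_⟩
          rintro rfl
          exact ⟨Finset.mem_univ _, ⟨h, lt_irrefl _⟩, rfl⟩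
        · simp only [Finset.notMem_empty, iff_false]
          rintro ⟨-, ⟨hj, -⟩, rfl⟩
          exact h hj
      rw [this]
      split_ifs <;> simp
  rw [h3] at h2
  omega

theorem upperArcs_eq {σ : Equiv.Perm (Fin n)} {i : Fin n} (hi : i < σ i) :
    upperArcs σ i = crossing σ i + nesting σ i := by
  rw [upperArcs, card_filter_split _ fun j => σ j < σ i, crossing, nesting]
  congr 2
  · exact Finset.filter_congr fun j _ => and_assoc
  · refine Finset.filter_congr fun j _ => ?_
    rw [and_assoc]
    refine and_congr_right fun hj => ?_
    rw [not_lt]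
    exact ⟨fun h => lt_of_le_of_ne h.2 (σ.injective.ne hj.ne'), fun h => ⟨hi.trans h, h.le⟩⟩

theorem lowerArcs_eq {σ : Equiv.Perm (Fin n)} {i : Fin n} (hi : σ i < i) :
    lowerArcs σ i = lowerCrossing σ i + lowerNesting σ i := by
  rw [lowerArcs, card_filter_split _ fun j => σ i < σ j, lowerCrossing, lowerNesting]
  congr 2
  · exact Finset.filter_congr fun j _ => and_assoc
  · refine Finset.filter_congr fun j _ => ?_
    rw [and_assoc]
    refine and_congr_right fun hj => ?_
    rw [not_lt]
    exact ⟨fun h => lt_of_le_of_ne h.2 (σ.injective.ne hj.ne'), fun h => ⟨h.trans hi, h.le⟩⟩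

/-- An upper arc from `j` passes over `σ j - j - 1` points; truncated subtraction gives `0`
elsewhere. -/
theorem sum_upperArcs (σ : Equiv.Perm (Fin n)) :
    ∑ i, upperArcs σ i + ∑ i, (if i < σ i then 1 else 0) = ∑ i, ((σ i : ℕ) - (i : ℕ)) := by
  have h : ∑ i, upperArcs σ i = ∑ j, ((σ j : ℕ) - (j : ℕ) - 1) := by
    simp only [upperArcs, Finset.card_filter]
    rw [Finset.sum_comm]
    refine Finset.sum_congr rfl fun j _ => ?_
    rw [← Finset.card_filter, ← Fin.card_Ioo]
    congr 1
    ext i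
    simp
  rw [h, ← Finset.sum_add_distrib]
  refine Finset.sum_congr rfl fun j _ => ?_
  split_ifs with hj
  · have : (j : ℕ) < σ j := hj
    omega
  · have : (σ j : ℕ) ≤ j := not_lt.1 hj
    omega

theorem sum_apply_sub (σ : Equiv.Perm (Fin n)) :
    ∑ i : Fin n, ((σ i : ℕ) - (i : ℕ)) = ∑ i : Fin n, ((i : ℕ) - (σ i : ℕ)) := by
  have h1 : ∑ i, (σ i : ℕ) = ∑ i : Fin n, (i : ℕ) := Equiv.sum_comp σ fun i => (i : ℕ)
  have h2 : ∑ i : Fin n, ((σ i : ℕ) - (i : ℕ)) + ∑ i : Fin n, (i : ℕ)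
      = ∑ i : Fin n, ((i : ℕ) - (σ i : ℕ)) + ∑ i, (σ i : ℕ) := by
    rw [← Finset.sum_add_distrib, ← Finset.sum_add_distrib]
    exact Finset.sum_congr rfl fun i _ => by omega
  omega

/-- The exponent of `-1` that an element contributes to `(-1) ^ cyc`. -/
def signExponent (σ : Equiv.Perm (Fin n)) (i : Fin n) : ℕ :=
  match permType σ i with
  | .val => crossing σ i
  | .peak => lowerCrossing σ i + 1
  | .dfall => lowerCrossing σ i
  | .drise => crossing σ i
  | .fixed => 1

/-- On summation the right side becomes even: the first two terms add up to the total upward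
displacement, the third to the equal downward displacement. Hence inversions plus sign exponents
have the parity of `n`. The doubled indicator corrects peaks and fixed points. -/
theorem nesting_add_signExponent (σ : Equiv.Perm (Fin n)) (i : Fin n) :
    nesting σ i + signExponent σ i + 1
      = upperArcs σ i + (if i < σ i then 1 else 0) + ((i : ℕ) - (σ i : ℕ))
        + 2 * if σ i ≤ i ∧ ¬ i < σ⁻¹ i then 1 else 0 := by
  obtain ⟨hval, hpeak, hdfall, hdrise, hfix⟩ := permType_spec σ i
  have hn := nesting_add_apply σ i
  have hb := upperArcs_balance σ i
  have up : i < σ i → nesting σ i + crossing σ i + 1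
      = upperArcs σ i + (if i < σ i then 1 else 0) + ((i : ℕ) - (σ i : ℕ))
        + 2 * if σ i ≤ i ∧ ¬ i < σ⁻¹ i then 1 else 0 := by
    intro h
    have h' : (i : ℕ) < σ i := h
    rw [upperArcs_eq h, if_pos h, if_neg fun e => h.not_ge e.1]
    omega
  unfold signExponent
  cases h : permType σ i
  · exact up (hval.1 h).2
  · obtain ⟨h1, h2⟩ := hpeak.1 h
    have h' : (σ i : ℕ) < i := h2
    rw [lowerArcs_eq h2, if_pos h1, if_pos h2] at hb
    rw [if_neg h2.not_gt, if_pos ⟨h2.le, h1.not_gt⟩]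
    simp only
    omega
  · obtain ⟨h1, h2⟩ := hdfall.1 h
    have h' : (σ i : ℕ) < i := h2
    rw [lowerArcs_eq h2, if_neg h1.not_gt, if_pos h2] at hb
    rw [if_neg h2.not_gt, if_neg fun e => e.2 h1]
    simp only
    omega
  · exact up (hdrise.1 h).2
  · have h1 := hfix.1 h
    have h2 : σ⁻¹ i = i := Equiv.Perm.inv_eq_iff_eq.2 h1.symm
    have h3 : nesting σ i = upperArcs σ i := by rw [nesting, upperArcs, h1]
    rw [h3, h2, h1]
    simp

theorem neg_one_pow_cyc_eq (σ : Equiv.Perm (Fin n)) :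
    (-1 : ℤ) ^ cyc σ = ∏ i, (-1) ^ signExponent σ i := by
  rw [neg_one_pow_cyc, sign_eq_neg_one_pow_sum_nesting, ← pow_add, Finset.prod_pow_eq_pow_sum]
  have h := Finset.sum_congr (rfl : Finset.univ = (Finset.univ : Finset (Fin n)))
    fun i _ => nesting_add_signExponent σ i
  simp only [Finset.sum_add_distrib, ← Finset.mul_sum] at h
  rw [sum_upperArcs, sum_apply_sub] at h
  simp only [Finset.sum_const, Finset.card_univ, Fintype.card_fin, smul_eq_mul, mul_one] at h
  apply neg_one_pow_congr
  rw [Nat.even_iff, Nat.even_iff]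
  omega

end Sign

/-! ### Absorbing the sign into the weights -/

theorem permWeight_eq_prod {R : Type*} [CommRing R] {n : ℕ} (a b c d : ℕ → ℕ → R) (e : ℕ → R)
    (σ : Equiv.Perm (Fin n)) :
    permWeight a b c d e σ = ∏ i, match permType σ i with
      | .val => a (ucross i σ) (unest i σ)
      | .peak => b (lcross i σ) (lnest i σ)
      | .dfall => c (lcross i σ) (lnest i σ)
      | .drise => d (ucross i σ) (unest i σ)
      | .fixed => e (psnest i σ) := by
  simp only [permWeight, Cval_eq, Cpeak_eq, Cdfall_eq, Cdrise_eq, Fix_eq,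
    Finset.prod_filter, ← Finset.prod_mul_distrib]
  refine Finset.prod_congr rfl fun i _ => ?_
  cases permType σ i <;> simp

theorem neg_one_pow_cyc_mul_permWeight {R : Type*} [CommRing R] {n : ℕ} (a b c d : ℕ → ℕ → R)
    (e : ℕ → R) (σ : Equiv.Perm (Fin n)) :
    (-1) ^ cyc σ * permWeight a b c d e σ
      = permWeight (fun l m => (-1) ^ l * a l m) (fun l m => -((-1) ^ l * b l m))
          (fun l m => (-1) ^ l * c l m) (fun l m => (-1) ^ l * d l m) (fun l => -e l) σ := by
  have h : (-1 : R) ^ cyc σ = ∏ i, (-1) ^ signExponent σ i := by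
    simpa using congrArg (Int.cast : ℤ → R) (neg_one_pow_cyc_eq σ)
  rw [h, permWeight_eq_prod, permWeight_eq_prod, ← Finset.prod_mul_distrib]
  refine Finset.prod_congr rfl fun i _ => ?_
  unfold signExponent
  rw [← ucross_eq_crossing, ← lcross_eq_lowerCrossing]
  cases permType σ i <;> simp [pow_succ]

theorem masterP_neg_one {R : Type*} [CommRing R] (a b c d : ℕ → ℕ → R) (e : ℕ → R) (n : ℕ) :
    masterP a b c d e (-1) n
      = pathSum (diagSum fun l m => (-1) ^ l * a l m) (diagSum fun l m => -((-1) ^ l * b l m))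
          (diagSum fun l m => (-1) ^ l * c l m) (diagSum fun l m => (-1) ^ l * d l m)
          (fun l => -e l) 0 n := by
  rw [← sum_permWeight, masterP]
  refine Finset.sum_congr rfl fun σ _ => ?_
  rw [← neg_one_pow_cyc_mul_permWeight, permWeight]
  ring

end MasterJ

theorem proposition4p1 {R : Type*} [CommRing R] (a b c d : ℕ → ℕ → R) (e : ℕ → R) :
    MasterJ.HasJFraction
      (PowerSeries.mk fun n => MasterJ.masterP a b c d e (-1) n)
      (fun n => (∑ l ∈ Finset.range n, (-1) ^ l * c l (n - 1 - l))
        + (∑ l ∈ Finset.range n, (-1) ^ l * d l (n - 1 - l)) - e n)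
      (fun n => -((∑ l ∈ Finset.range n, (-1) ^ l * a l (n - 1 - l))
        * (∑ l ∈ Finset.range n, (-1) ^ l * b l (n - 1 - l)))) := by
  simp only [MasterJ.masterP_neg_one]
  convert MasterJ.hasJFraction_pathSum (va := MasterJ.diagSum fun l m => (-1) ^ l * a l m)
    (vb := MasterJ.diagSum fun l m => -((-1) ^ l * b l m))
    (vc := MasterJ.diagSum fun l m => (-1) ^ l * c l m)
    (vd := MasterJ.diagSum fun l m => (-1) ^ l * d l m) (ve := fun l => -e l)
    -- An antidiagonal sum over an empty range vanishes, so no path descends from height `0`.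
    (by simp [MasterJ.diagSum]) using 1
  · funext n
    simp only [MasterJ.diagSum]
    ring
  · funext n
    simp only [MasterJ.diagSum, Finset.sum_neg_distrib]
    ring
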